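/- Let $\lambda>0$, $\sigma\ge 0$, $T>0$. In the planar random waypoint model, let $t_1,t_2,\dots$ (leg durations), $u_1,u_2,\dots$ and $v_1,v_2,\dots$ (velocity components) be mutually independent random variables, where each $t_k$ is exponential with rate $\lambda$ (mean $1/\lambda$) and each $u_k$ and each $v_k$ is normal with mean $0$ and standard deviation $\sigma$. Put $T_i=t_1+\dots+t_i$, $T_0=0$, and let $N(t)$ be the number of $i\ge 1$ with $T_i\le t$. The sensor starts at the origin at time $0$, and its position at time $t\ge 0$ is $(X_t,Y_t)$ with $$X_t=\sum_{k=1}^{N(t)}u_kt_k+(t-T_{N(t)})\,u_{N(t)+1},\qquad Y_t=\sum_{k=1}^{N(t)}v_kt_k+(t-T_{N(t)})\,v_{N(t)+1}.$$ MAINT estimates the position at time $t\in[0,T]$ from the exact positions at the times $0$ and $T$ by linear interpolation, that is, by $\left(\frac{t}{T}X_T,\frac{t}{T}Y_T\right)$. Let $$\mathrm{error}_t=E\left[\left(X_t-\tfrac tT X_T\right)^2+\left(Y_t-\tfrac tT Y_T\right)^2\right],\qquad \mathrm{error(avg)}=\frac1T\int_0^T\mathrm{error}_t\,dt .$$ 1.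 For every $t\in[0,T]$ the squared error is integrable, and $$\mathrm{error}_t=\frac{4\sigma^2}{\lambda^2T^2}\Big[t^2\big(\lambda(T-t)-1+e^{-\lambda(T-t)}\big)+(T-t)^2\big(\lambda t-1+e^{-\lambda t}\big)-(1+e^{-\lambda T})\,t(T-t)+t(T-t)e^{-\lambda t}+t(T-t)e^{-\lambda(T-t)}\Big].$$ 2. The function $t\mapsto\mathrm{error}_t$ is integrable on $[0,T]$, and $$\mathrm{error(avg)}=\frac{2\sigma^2}{3\lambda^2}\left[\lambda T-5+\frac{12}{\lambda T}-\frac{12}{(\lambda T)^2}+\frac{12}{(\lambda T)^2}e^{-\lambda T}-e^{-\lambda T}\right].$$ 3. Let $C>0$ and $\sigma$ be fixed. If $T$ and $\lambda$ grow with $T=C\lambda$ (that is, $\lambda=T/C$), then $\mathrm{error(avg)}\to\dfrac{2\sigma^2C}{3}$ as $T\to\infty$. -/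

import Mathlib

namespace RandomWaypoint

open MeasureTheory ProbabilityTheory
open scoped NNReal

noncomputable section

/-- The driving random variables of the planar random waypoint model.  Legs are numbered from `0`:
the leg `k` has duration `τ k` and constant velocity `(u k, v k)`.  All durations and velocity
components are mutually independent; durations are exponential with rate `lam` (mean `1 / lam`),
velocity components are centred normal with standard deviation `σ`. -/
structure IsModel {Ω : Type*} [MeasurableSpace Ω] (P : Measure Ω) (lam : ℝ) (σ : ℝ≥0)
    (τ u v : ℕ → Ω → ℝ) : Prop where
  law_duration : ∀ k, HasLaw (τ k) (expMeasure lam) P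
  law_velocity_x : ∀ k, HasLaw (u k) (gaussianReal 0 (σ ^ 2)) P
  law_velocity_y : ∀ k, HasLaw (v k) (gaussianReal 0 (σ ^ 2)) P
  indep : iIndepFun (Sum.elim τ (Sum.elim u v) : ℕ ⊕ ℕ ⊕ ℕ → Ω → ℝ) P

variable {Ω : Type*}

/-- The time at which the `i`-th waypoint is reached; the `0`-th waypoint is the start. -/
def waypointTime (τ : ℕ → Ω → ℝ) (i : ℕ) (ω : Ω) : ℝ :=
  ∑ k ∈ Finset.range i, τ k ω

/-- The number of waypoints (the start not counted) reached by time `t`.  Almost surely it is finite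
and is the unique `i` with `waypointTime τ i ω ≤ t < waypointTime τ (i + 1) ω`, for `0 ≤ t`. -/
def waypointCount (τ : ℕ → Ω → ℝ) (t : ℝ) (ω : Ω) : ℕ :=
  Set.ncard {k : ℕ | waypointTime τ (k + 1) ω ≤ t}

/-- One coordinate of the `i`-th waypoint, where `u` is the sequence of velocity components of the
legs in that coordinate; the start is the origin. -/
def waypointCoord (τ u : ℕ → Ω → ℝ) (i : ℕ) (ω : Ω) : ℝ :=
  ∑ k ∈ Finset.range i, u k ω * τ k ω

/-- One coordinate of the position at time `t`: the coordinate of the last waypoint reached, plus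
the displacement on the leg in progress. -/
def coord (τ u : ℕ → Ω → ℝ) (t : ℝ) (ω : Ω) : ℝ :=
  waypointCoord τ u (waypointCount τ t ω) ω
    + (t - waypointTime τ (waypointCount τ t ω) ω) * u (waypointCount τ t ω) ω

/-- One coordinate of the estimate at time `t`, by linear interpolation between the origin
at time `0` and the true position at time `T`. -/
def estCoord (τ u : ℕ → Ω → ℝ) (T t : ℝ) (ω : Ω) : ℝ :=
  coord τ u T ω / T * t

/-- The squared Euclidean distance between the true and the estimated position at time `t`. -/
def sqError (τ u v : ℕ → Ω → ℝ) (T t : ℝ) (ω : Ω) : ℝ :=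
  (coord τ u t ω - estCoord τ u T t ω) ^ 2 + (coord τ v t ω - estCoord τ v T t ω) ^ 2

variable [MeasurableSpace Ω]

/-- The expected squared error at time `t`. -/
def errorAt (P : Measure Ω) (τ u v : ℕ → Ω → ℝ) (T t : ℝ) : ℝ :=
  ∫ ω, sqError τ u v T t ω ∂P

/-- The average over `t ∈ [0, T]` of the expected squared error. -/
def errorAvg (P : Measure Ω) (τ u v : ℕ → Ω → ℝ) (T : ℝ) : ℝ :=
  (1 / T) * ∫ t in (0 : ℝ)..T, errorAt P τ u v T t

end

end RandomWaypoint

namespace RandomWaypoint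

open MeasureTheory ProbabilityTheory Filter Topology Set
open scoped NNReal ENNReal

/-! Everything reduces to the covariance of one coordinate at two times `s ≤ t`. Given the
durations, the position is linear in the velocities, the coefficient of leg `k` being the time `stay
x k t` spent in it. The velocities are centred and uncorrelated, so the conditional covariance is `σ
^ 2` times the sum over `k` of `stay x k s * stay x k t`. This sum is the area of the set of pairs
`(r, q)` in `(0, s] × (0, t]` lying in the same leg (`Regular.sum_stay_mul_stay`).

By Fubini the expected area is the double integral of the probability that `r` and `q` share a leg.
Memorylessness of the exponential law gives `exp (-lam * |r - q|)` for that probability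
(`durationLaw_arrival_le_lt`, summed over the legs in `durationLaw_sameLeg_of_le`), so neither the
Poisson law of the count nor the gamma law of the arrival times is computed.

Expanding the square of `X_t - (t / T) X_T` and doubling for the two coordinates gives the error; an
explicit antiderivative gives its average, and the limit is read off from that. -/

/-! ### Integrals of the exponential kernel. -/

theorem integral_exp_neg_mul_sub {lam : ℝ} (hl : lam ≠ 0) (a b c : ℝ) :
    ∫ q in a..b, Real.exp (-(lam * (q - c)))
      = (Real.exp (-(lam * (a - c))) - Real.exp (-(lam * (b - c)))) / lam := by
  have hd : ∀ q ∈ uIcc a b, HasDerivAt (fun q => -Real.exp (-(lam * (q - c))) / lam)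
      (Real.exp (-(lam * (q - c)))) q := by
    intro q _
    have h1 : HasDerivAt (fun q => -(lam * (q - c))) (-(lam * 1)) q :=
      (((hasDerivAt_id q).sub_const c).const_mul lam).neg
    refine (h1.exp.neg.div_const lam).congr_deriv ?_
    field_simp
  rw [intervalIntegral.integral_eq_sub_of_hasDerivAt hd
    (Continuous.intervalIntegrable (by fun_prop) _ _)]
  ring

theorem integral_exp_neg_mul_sub' {lam : ℝ} (hl : lam ≠ 0) (a b c : ℝ) :
    ∫ q in a..b, Real.exp (-(lam * (c - q)))
      = (Real.exp (-(lam * (c - b))) - Real.exp (-(lam * (c - a)))) / lam := by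
  have h := integral_exp_neg_mul_sub (neg_ne_zero.2 hl) a b c
  have e : ∀ q, -(-lam * (q - c)) = -(lam * (c - q)) := fun q => by ring
  simp only [e] at h
  rw [h]
  ring

/-- The covariance kernel of one coordinate of the path, up to the factor `σ ^ 2`. -/
noncomputable def covKernel (lam s t : ℝ) : ℝ :=
  (2 * s - (1 - Real.exp (-(lam * s)) + Real.exp (-(lam * (t - s))) - Real.exp (-(lam * t))) / lam)
    / lam

/-- The inner integral is split at `q = r`, where the absolute value changes branch; `s ≤ t` ensures
that `r` lies in `[0, t]`. -/
theorem integral_integral_exp_neg_abs {lam : ℝ} (hl : 0 < lam) {s t : ℝ} (hs : 0 ≤ s)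
    (hst : s ≤ t) :
    ∫ r in (0 : ℝ)..s, ∫ q in (0 : ℝ)..t, Real.exp (-(lam * |r - q|)) = covKernel lam s t := by
  have h1 : ∀ r ∈ uIcc 0 s, ∫ q in (0 : ℝ)..t, Real.exp (-(lam * |r - q|))
      = (2 - Real.exp (-(lam * (r - 0))) - Real.exp (-(lam * (t - r)))) / lam := by
    intro r hr
    rw [uIcc_of_le hs] at hr
    have hc : Continuous fun q => Real.exp (-(lam * |r - q|)) := by fun_prop
    rw [← intervalIntegral.integral_add_adjacent_intervals (b := r)
      (hc.intervalIntegrable _ _) (hc.intervalIntegrable _ _)]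
    have ha : ∫ q in (0 : ℝ)..r, Real.exp (-(lam * |r - q|))
        = ∫ q in (0 : ℝ)..r, Real.exp (-(lam * (r - q))) := by
      refine intervalIntegral.integral_congr fun q hq => ?_
      rw [uIcc_of_le hr.1] at hq
      rw [abs_of_nonneg (by linarith [hq.2])]
    have hb : ∫ q in r..t, Real.exp (-(lam * |r - q|))
        = ∫ q in r..t, Real.exp (-(lam * (q - r))) := by
      refine intervalIntegral.integral_congr fun q hq => ?_
      rw [uIcc_of_le (hr.2.trans hst)] at hq
      rw [abs_of_nonpos (by linarith [hq.1]), neg_sub]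
    rw [ha, hb, integral_exp_neg_mul_sub hl.ne', integral_exp_neg_mul_sub' hl.ne']
    simp
    ring
  rw [intervalIntegral.integral_congr h1, intervalIntegral.integral_div,
    intervalIntegral.integral_sub, intervalIntegral.integral_sub,
    integral_exp_neg_mul_sub hl.ne', integral_exp_neg_mul_sub' hl.ne']
  · unfold covKernel
    simp
    ring
  all_goals exact Continuous.intervalIntegrable (by fun_prop) _ _

/-! ### Closed forms of the error and its average, and the limit. -/

/-- The closed form of the expected squared error. -/
noncomputable def errorFormula (σ lam T t : ℝ) : ℝ :=
  4 * σ ^ 2 / (lam ^ 2 * T ^ 2) *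
    (t ^ 2 * (lam * (T - t) - 1 + Real.exp (-(lam * (T - t))))
      + (T - t) ^ 2 * (lam * t - 1 + Real.exp (-(lam * t)))
      - (1 + Real.exp (-(lam * T))) * (t * (T - t))
      + t * (T - t) * Real.exp (-(lam * t))
      + t * (T - t) * Real.exp (-(lam * (T - t))))

/-- The left side is the second moment of `X_t - (t / T) X_T` expanded by bilinearity; the factor 2
counts the coordinates. -/
theorem covKernel_combination {lam T : ℝ} (hl : lam ≠ 0) (hT : T ≠ 0) (σ t : ℝ) :
    2 * (σ ^ 2 * (covKernel lam t t - 2 * (t / T) * covKernel lam t T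
      + (t / T) ^ 2 * covKernel lam T T)) = errorFormula σ lam T t := by
  unfold covKernel errorFormula
  simp only [sub_self, mul_zero, neg_zero, Real.exp_zero]
  field_simp
  ring

/-- The closed form of the average expected squared error. -/
noncomputable def errorAvgFormula (σ lam T : ℝ) : ℝ :=
  2 * σ ^ 2 / (3 * lam ^ 2) *
    (lam * T - 5 + 12 / (lam * T) - 12 / (lam * T) ^ 2
      + 12 / (lam * T) ^ 2 * Real.exp (-(lam * T)) - Real.exp (-(lam * T)))

theorem integral_errorFormula {lam T : ℝ} (hl : lam ≠ 0) (hT : T ≠ 0) (σ : ℝ) :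
    1 / T * ∫ t in (0 : ℝ)..T, errorFormula σ lam T t = errorAvgFormula σ lam T := by
  -- The exponential terms merge before integration: `(T - t) ^ 2 + t (T - t) = T (T - t)`
  -- multiplies `exp (-(lam * t))`, and `t ^ 2 + t (T - t) = T t` multiplies `exp (-(lam * (T -
  -- t)))`. Integration by parts then gives the last two lines.
  let A : ℝ → ℝ := fun t =>
    lam * T ^ 2 * (t ^ 2 / 2) - T ^ 2 * t - lam * T * (t ^ 3 / 3) + T * (t ^ 2 / 2) - t ^ 3 / 3
      - Real.exp (-(lam * T)) * (T * (t ^ 2 / 2) - t ^ 3 / 3)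
      + T * ((t - T) / lam + 1 / lam ^ 2) * Real.exp (-(lam * t))
      + T * (t / lam - 1 / lam ^ 2) * Real.exp (-(lam * (T - t)))
  have hd : ∀ t ∈ uIcc 0 T, HasDerivAt (fun t => 4 * σ ^ 2 / (lam ^ 2 * T ^ 2) * A t)
      (errorFormula σ lam T t) t := by
    intro t _
    have e1 : HasDerivAt (fun t => -(lam * t)) (-(lam * 1)) t :=
      ((hasDerivAt_id t).const_mul lam).neg
    have e2 : HasDerivAt (fun t => -(lam * (T - t))) (-(lam * -1)) t :=
      (((hasDerivAt_id t).const_sub T).const_mul lam).neg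
    have p1 : HasDerivAt (fun t : ℝ => t) 1 t := hasDerivAt_id t
    have p2 : HasDerivAt (fun t : ℝ => t ^ 2 / 2) t t := by
      exact ((hasDerivAt_pow 2 t).div_const 2).congr_deriv (by simp)
    have p3 : HasDerivAt (fun t : ℝ => t ^ 3 / 3) (t ^ 2) t := by
      exact ((hasDerivAt_pow 3 t).div_const 3).congr_deriv (by simp)
    have := ((((((((p2.const_mul (lam * T ^ 2)).sub (p1.const_mul (T ^ 2))).sub
      (p3.const_mul (lam * T))).add (p2.const_mul T)).sub p3).sub
      (((p2.const_mul T).sub p3).const_mul (Real.exp (-(lam * T))))).add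
      (((((p1.sub_const T).div_const lam).add_const (1 / lam ^ 2)).const_mul T).mul e1.exp)).add
      ((((p1.div_const lam).sub_const (1 / lam ^ 2)).const_mul T).mul e2.exp))
    refine (this.const_mul (4 * σ ^ 2 / (lam ^ 2 * T ^ 2))).congr_deriv ?_
    unfold errorFormula
    congr 1
    field_simp
    ring
  rw [intervalIntegral.integral_eq_sub_of_hasDerivAt hd
    (Continuous.intervalIntegrable (by unfold errorFormula; fun_prop) _ _)]
  simp only [A, errorAvgFormula, sub_self, mul_zero, neg_zero, Real.exp_zero, sub_zero]
  field_simp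
  ring

/-- With `z = lam * T = T ^ 2 / C` one has `1 / lam ^ 2 = C / z`, so the average is `2 σ ^ 2 C / 3`
times the bracket divided by `z`, in which only the leading term survives. -/
theorem tendsto_errorAvgFormula (σ : ℝ) {C : ℝ} (hC : 0 < C) :
    Tendsto (fun T => errorAvgFormula σ (T / C) T) atTop (𝓝 (2 * σ ^ 2 * C / 3)) := by
  have hz : Tendsto (fun T : ℝ => T / C * T) atTop atTop :=
    (tendsto_id.atTop_div_const hC).atTop_mul_atTop₀ tendsto_id
  have hi : Tendsto (fun z : ℝ => z⁻¹) atTop (𝓝 0) := tendsto_inv_atTop_zero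
  have he : Tendsto (fun z : ℝ => Real.exp (-z)) atTop (𝓝 0) := Real.tendsto_exp_neg_atTop_nhds_zero
  have hB : Tendsto (fun z : ℝ => 2 * σ ^ 2 * C / 3 * (1 - 5 * z⁻¹ + 12 * z⁻¹ ^ 2 - 12 * z⁻¹ ^ 3
      + 12 * z⁻¹ ^ 3 * Real.exp (-z) - z⁻¹ * Real.exp (-z))) atTop (𝓝 (2 * σ ^ 2 * C / 3)) := by
    have := ((((((tendsto_const_nhds (x := (1 : ℝ))).sub (hi.const_mul 5)).add
      ((hi.pow 2).const_mul 12)).sub ((hi.pow 3).const_mul 12)).add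
      (((hi.pow 3).const_mul 12).mul he)).sub (hi.mul he)).const_mul (2 * σ ^ 2 * C / 3)
    simpa using this
  refine (hB.comp hz).congr' ?_
  filter_upwards [eventually_gt_atTop 0] with T hT
  simp only [Function.comp, errorAvgFormula]
  field_simp

/-! ### Joint law of two independent families. -/

theorem map_sumElim_prod_infinitePi {ι κ 𝓧 : Type*} [MeasurableSpace 𝓧] (μ : ι → Measure 𝓧)
    (ν : κ → Measure 𝓧) [∀ i, IsProbabilityMeasure (μ i)] [∀ i, IsProbabilityMeasure (ν i)]
    [∀ i, IsProbabilityMeasure (Sum.elim μ ν i)] :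
    ((Measure.infinitePi μ).prod (Measure.infinitePi ν)).map (fun p => Sum.elim p.1 p.2)
      = Measure.infinitePi (Sum.elim μ ν) := by
  have hm : Measurable (fun p : (ι → 𝓧) × (κ → 𝓧) => (Sum.elim p.1 p.2 : ι ⊕ κ → 𝓧)) := by
    refine measurable_pi_iff.2 ?_
    rintro (i | j)
    · exact (measurable_pi_apply i).comp measurable_fst
    · exact (measurable_pi_apply j).comp measurable_snd
  refine Measure.eq_infinitePi _ fun s t ht => ?_
  rw [Measure.map_apply hm (MeasurableSet.pi s.countable_toSet fun i _ => ht i)]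
  have : (fun p : (ι → 𝓧) × (κ → 𝓧) => (Sum.elim p.1 p.2 : ι ⊕ κ → 𝓧)) ⁻¹' Set.pi s t
      = Set.pi s.toLeft (fun i => t (.inl i)) ×ˢ Set.pi s.toRight (fun j => t (.inr j)) := by
    ext p
    simp [Set.mem_pi]
  rw [this, Measure.prod_prod, Measure.infinitePi_pi _ fun i _ => ht _,
    Measure.infinitePi_pi _ fun i _ => ht _]
  conv_rhs => rw [← Finset.toLeft_disjSum_toRight (u := s), Finset.prod_disjSum]
  rfl

/-- Mutual independence becomes a product of two measures on sequences, so that conditioning on the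
durations is Fubini. -/
theorem hasLaw_pair {Ω ι κ 𝓧 : Type*} [MeasurableSpace Ω] {P : Measure Ω} [MeasurableSpace 𝓧]
    [Countable ι] [Countable κ] {μ : ι → Measure 𝓧} {ν : κ → Measure 𝓧}
    [∀ i, IsProbabilityMeasure (μ i)] [∀ i, IsProbabilityMeasure (ν i)]
    {X : ι → Ω → 𝓧} {Y : κ → Ω → 𝓧} (hX : ∀ i, HasLaw (X i) (μ i) P)
    (hY : ∀ j, HasLaw (Y j) (ν j) P) (h : iIndepFun (Sum.elim X Y) P) :
    HasLaw (fun ω => ((fun i => X i ω), (fun j => Y j ω)))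
      ((Measure.infinitePi μ).prod (Measure.infinitePi ν)) P := by
  have hXm : AEMeasurable (fun ω i => X i ω) P := aemeasurable_pi_iff.2 fun i => (hX i).aemeasurable
  have hYm : AEMeasurable (fun ω j => Y j ω) P := aemeasurable_pi_iff.2 fun i => (hY i).aemeasurable
  have : ∀ i, IsProbabilityMeasure (Sum.elim μ ν i) := by rintro (i | j) <;> simp <;> infer_instance
  have hZ : ∀ i, HasLaw (Sum.elim X Y i) (Sum.elim μ ν i) P := by
    rintro (i | j)
    exacts [hX i, hY j]
  have hlaw := h.hasLaw_infinitePi hZ (aemeasurable_pi_iff.2 fun i => (hZ i).aemeasurable)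
  let g : (ι ⊕ κ → 𝓧) → (ι → 𝓧) × (κ → 𝓧) := fun z => (fun i => z (.inl i), fun j => z (.inr j))
  have hg : Measurable g := by fun_prop
  have hm : Measurable (fun p : (ι → 𝓧) × (κ → 𝓧) => (Sum.elim p.1 p.2 : ι ⊕ κ → 𝓧)) := by
    refine measurable_pi_iff.2 ?_
    rintro (i | j)
    · exact (measurable_pi_apply i).comp measurable_fst
    · exact (measurable_pi_apply j).comp measurable_snd
  have hgl : HasLaw g ((Measure.infinitePi μ).prod (Measure.infinitePi ν))
      (Measure.infinitePi (Sum.elim μ ν)) := by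
    refine ⟨hg.aemeasurable, ?_⟩
    rw [← map_sumElim_prod_infinitePi, Measure.map_map hg hm]
    exact Measure.map_id
  exact hgl.comp hlaw

/-! ### Arrival times under the law of the durations. -/

/-- The arrival times of the sequence `x` of durations. -/
noncomputable def arrival (x : ℕ → ℝ) (k : ℕ) : ℝ := ∑ i ∈ Finset.range k, x i

theorem arrival_succ (x : ℕ → ℝ) (k : ℕ) : arrival x (k + 1) = arrival x k + x k :=
  Finset.sum_range_succ _ _

@[simp] theorem arrival_zero (x : ℕ → ℝ) : arrival x 0 = 0 := Finset.sum_range_zero _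

@[fun_prop] theorem measurable_arrival (k : ℕ) : Measurable fun x => arrival x k := by
  unfold arrival; fun_prop

theorem expMeasure_Ioi {lam : ℝ} (hl : 0 < lam) {a : ℝ} (ha : 0 ≤ a) :
    expMeasure lam (Ioi a) = ENNReal.ofReal (Real.exp (-(lam * a))) := by
  have := isProbabilityMeasure_expMeasure hl
  have h := cdf_expMeasure_eq hl a
  rw [if_pos ha, cdf_eq_real] at h
  rw [← compl_Iic, ← ofReal_measureReal, probReal_compl_eq_one_sub measurableSet_Iic, h]
  congr 1; ring

theorem expMeasure_Iio_zero {lam : ℝ} (hl : 0 < lam) : expMeasure lam (Iio 0) = 0 := by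
  have := isProbabilityMeasure_expMeasure hl
  have h := cdf_expMeasure_eq hl 0
  rw [if_pos le_rfl, cdf_eq_real] at h
  have h2 : expMeasure lam (Iic 0) = 0 := by
    rw [← measureReal_eq_zero_iff, h]; simp
  exact measure_mono_null Iio_subset_Iic_self h2

/-- The law of the sequence of leg durations. -/
noncomputable def durationLaw (lam : ℝ) : Measure (ℕ → ℝ) :=
  Measure.infinitePi fun _ => expMeasure lam

theorem isProbabilityMeasure_durationLaw {lam : ℝ} (hl : 0 < lam) :
    IsProbabilityMeasure (durationLaw lam) := by
  have := isProbabilityMeasure_expMeasure hl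
  unfold durationLaw; infer_instance

theorem iIndepFun_infinitePi_eval {ι : Type*} {X : ι → Type*} [∀ i, MeasurableSpace (X i)]
    (μ : ∀ i, Measure (X i)) [∀ i, IsProbabilityMeasure (μ i)] :
    iIndepFun (fun i (x : ∀ i, X i) => x i) (Measure.infinitePi μ) :=
  iIndepFun_infinitePi (X := fun _ x => x) fun _ => measurable_id

theorem ae_durationLaw_nonneg {lam : ℝ} (hl : 0 < lam) :
    ∀ᵐ x ∂durationLaw lam, ∀ k, 0 ≤ x k := by
  have := isProbabilityMeasure_expMeasure hl
  rw [ae_all_iff]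
  intro k
  have h := (measurePreserving_eval_infinitePi (fun _ : ℕ => expMeasure lam) k).measure_preimage
    (measurableSet_Iio (a := (0 : ℝ))).nullMeasurableSet
  rw [expMeasure_Iio_zero hl] at h
  filter_upwards [measure_eq_zero_iff_ae_notMem.1 h] with x hx
  simpa using hx

/-- The events `1 < x k` are independent with the same positive probability, so by the second
Borel–Cantelli lemma almost surely infinitely many occur, and each adds more than 1 to the sum of
the nonnegative durations. -/
theorem ae_durationLaw_unbounded {lam : ℝ} (hl : 0 < lam) :
    ∀ᵐ x ∂durationLaw lam, ∀ a : ℝ, ∃ k, a < arrival x k := by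
  have := isProbabilityMeasure_expMeasure hl
  have hprob := isProbabilityMeasure_durationLaw hl
  have hmeas : ∀ k, MeasurableSet {x : ℕ → ℝ | 1 < x k} := fun k =>
    measurableSet_lt measurable_const (measurable_pi_apply k)
  have hval : ∀ k, durationLaw lam {x | 1 < x k} = ENNReal.ofReal (Real.exp (-(lam * 1))) := by
    intro k
    rw [← expMeasure_Ioi hl zero_le_one]
    exact (measurePreserving_eval_infinitePi (fun _ : ℕ => expMeasure lam) k).measure_preimage
      (measurableSet_Ioi (a := (1 : ℝ))).nullMeasurableSet
  have hind : iIndepSet (fun k => {x : ℕ → ℝ | 1 < x k}) (durationLaw lam) := by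
    rw [iIndepSet_iff_meas_biInter hmeas]
    intro s
    have := (iIndepFun_infinitePi_eval fun _ : ℕ => expMeasure lam).measure_inter_preimage_eq_mul s
      (sets := fun _ => Ioi 1) (fun _ _ => measurableSet_Ioi)
    exact this
  have hlim := measure_limsup_eq_one hmeas hind (by
    simp_rw [hval]
    exact ENNReal.tsum_const_eq_top_of_ne_zero (by simp [Real.exp_pos]))
  have hlim' : ∀ᵐ x ∂durationLaw lam, x ∈ limsup (fun k => {x : ℕ → ℝ | 1 < x k}) atTop :=
    (prob_compl_eq_zero_iff (MeasurableSet.measurableSet_limsup hmeas)).2 hlim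
  filter_upwards [hlim', ae_durationLaw_nonneg hl] with x hx h0 a
  rw [mem_limsup_iff_frequently_mem] at hx
  have key : ∀ n : ℕ, ∃ k, (n : ℝ) ≤ arrival x k := by
    intro n
    induction n with
    | zero => exact ⟨0, by simp⟩
    | succ n ih =>
      obtain ⟨k, hk⟩ := ih
      obtain ⟨m, hm, hxm⟩ := frequently_atTop.1 hx k
      refine ⟨m + 1, ?_⟩
      have hmono : arrival x k ≤ arrival x m :=
        monotone_nat_of_le_succ (fun n => by rw [arrival_succ]; linarith [h0 n]) hm
      rw [arrival_succ]
      have : 1 < x m := hxm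
      push_cast
      linarith
  obtain ⟨n, hn⟩ := exists_nat_gt a
  obtain ⟨k, hk⟩ := key n
  exact ⟨k, hn.trans_le hk⟩

/-- The leg `k` is in progress at time `r`. -/
def InLeg (x : ℕ → ℝ) (k : ℕ) (r : ℝ) : Prop := arrival x k ≤ r ∧ r < arrival x (k + 1)

theorem measurableSet_inLeg (k : ℕ) : MeasurableSet {p : (ℕ → ℝ) × ℝ | InLeg p.1 k p.2} :=
  (measurableSet_le ((measurable_arrival k).comp measurable_fst) measurable_snd).inter
    (measurableSet_lt measurable_snd ((measurable_arrival (k + 1)).comp measurable_fst))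

/-- Memorylessness: the leg in progress at time `r` lasts beyond `q` with probability
`exp (-lam (q - r))`, whichever its number. -/
theorem durationLaw_arrival_le_lt {lam : ℝ} (hl : 0 < lam) (k : ℕ) {r q : ℝ} (hrq : r ≤ q) :
    durationLaw lam {x | arrival x k ≤ r ∧ q < arrival x (k + 1)}
      = ENNReal.ofReal (Real.exp (-(lam * (q - r)))) * durationLaw lam {x | InLeg x k r} := by
  have := isProbabilityMeasure_expMeasure hl
  have hprob := isProbabilityMeasure_durationLaw hl
  have hind : IndepFun (fun x => arrival x k) (fun x : ℕ → ℝ => x k) (durationLaw lam) := by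
    have h := (iIndepFun_infinitePi_eval fun _ : ℕ => expMeasure lam).indepFun_sum_range_succ
      (fun i => measurable_pi_apply i) k
    convert! h using 1
    ext x
    simp [arrival]
  have hmap := (indepFun_iff_map_prod_eq_prod_map_map (measurable_arrival k).aemeasurable
    (measurable_pi_apply k).aemeasurable).1 hind
  have hev : (durationLaw lam).map (fun x => x k) = expMeasure lam :=
    Measure.infinitePi_map_eval (fun _ : ℕ => expMeasure lam) k
  rw [hev] at hmap
  -- The start `s` of leg `k` is independent of its duration, and the leg outlasts `q` with
  -- probability `exp (-lam (q - s))`. Comparing this with the case `q = r` extracts the factor `exp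
  -- (-lam (q - r))`, whatever the law of `s`.
  have main : ∀ q, r ≤ q → durationLaw lam {x | arrival x k ≤ r ∧ q < arrival x (k + 1)}
      = ∫⁻ s in Iic r, ENNReal.ofReal (Real.exp (-(lam * (q - s))))
          ∂(durationLaw lam).map (fun x => arrival x k) := by
    intro q hq
    have hms : MeasurableSet {p : ℝ × ℝ | p.1 ≤ r ∧ q < p.1 + p.2} :=
      (measurableSet_le measurable_fst measurable_const).inter
        (measurableSet_lt measurable_const (measurable_fst.add measurable_snd))
    have h1 : {x | arrival x k ≤ r ∧ q < arrival x (k + 1)}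
        = (fun x => (arrival x k, x k)) ⁻¹' {p : ℝ × ℝ | p.1 ≤ r ∧ q < p.1 + p.2} := by
      ext x; simp [arrival_succ]
    have hmm : Measurable fun x : ℕ → ℝ => (arrival x k, x k) := by fun_prop
    rw [h1, ← Measure.map_apply hmm hms, hmap,
      Measure.prod_apply hms, ← lintegral_indicator measurableSet_Iic]
    refine lintegral_congr fun s => ?_
    by_cases hs : s ≤ r
    · rw [indicator_of_mem (by exact hs), ← expMeasure_Ioi hl (by linarith)]
      congr 1
      ext z
      simp [hs, sub_lt_iff_lt_add']
    · rw [indicator_of_notMem (by exact hs)]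
      simp [hs]
  have h2 := main r le_rfl
  unfold InLeg
  rw [main q hrq, h2, ← lintegral_const_mul _ (by fun_prop)]
  refine lintegral_congr fun s => ?_
  rw [← ENNReal.ofReal_mul (Real.exp_nonneg _), ← Real.exp_add]
  congr 2
  ring

/-! ### The path for a fixed regular sequence of durations. -/

/-- A sequence of durations is regular if it is nonnegative and has an infinite sum. -/
structure Regular (x : ℕ → ℝ) : Prop where
  nonneg : ∀ k, 0 ≤ x k
  unbounded : ∀ a : ℝ, ∃ k, a < arrival x k

theorem ae_durationLaw_regular {lam : ℝ} (hl : 0 < lam) : ∀ᵐ x ∂durationLaw lam, Regular x := by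
  filter_upwards [ae_durationLaw_nonneg hl, ae_durationLaw_unbounded hl] with x h1 h2
  exact ⟨h1, h2⟩

/-- The number of the leg in progress at time `t`. -/
noncomputable def leg (x : ℕ → ℝ) (t : ℝ) : ℕ := Set.ncard {k : ℕ | arrival x (k + 1) ≤ t}

/-- The time spent in the leg `k` up to time `t`. -/
noncomputable def stay (x : ℕ → ℝ) (k : ℕ) (t : ℝ) : ℝ :=
  min (arrival x (k + 1)) t - min (arrival x k) t

/-- The position at time `t` as a function of the durations `x` and the velocities `y`. -/
noncomputable def path (x y : ℕ → ℝ) (t : ℝ) : ℝ :=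
  ∑ k ∈ Finset.range (leg x t), y k * x k + (t - arrival x (leg x t)) * y (leg x t)

namespace Regular

variable {x : ℕ → ℝ}

theorem monotone_arrival (hx : Regular x) : Monotone (arrival x) :=
  monotone_nat_of_le_succ fun n => by rw [arrival_succ]; linarith [hx.nonneg n]

theorem inLeg_leg (hx : Regular x) {t : ℝ} (ht : 0 ≤ t) : InLeg x (leg x t) t := by
  classical
  have hex := hx.unbounded t
  obtain ⟨m, hm⟩ : ∃ m, Nat.find hex = m + 1 := by
    refine Nat.exists_eq_succ_of_ne_zero fun h => ?_
    have := Nat.find_spec hex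
    rw [h, arrival_zero] at this
    linarith
  have hlt : t < arrival x (m + 1) := hm ▸ Nat.find_spec hex
  have hle : arrival x m ≤ t := not_lt.1 (Nat.find_min hex (by omega))
  -- Since `arrival x (m + 1)` already exceeds `t`, the set is finite and `ncard` is a true count
  -- rather than its default value 0.
  have hset : {k : ℕ | arrival x (k + 1) ≤ t} = (Finset.range m : Set ℕ) := by
    ext k
    simp only [mem_ofPred_eq, Finset.coe_range, mem_Iio]
    constructor
    · intro h
      by_contra hk
      have := hx.monotone_arrival (show m + 1 ≤ k + 1 by omega)
      linarith
    · intro h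
      exact (hx.monotone_arrival (show k + 1 ≤ m by omega)).trans hle
  have hleg : leg x t = m := by
    unfold leg
    rw [hset, Set.ncard_coe_finset, Finset.card_range]
  rw [hleg]
  exact ⟨hle, hlt⟩

theorem inLeg_iff (hx : Regular x) {t : ℝ} (ht : 0 ≤ t) {k : ℕ} : InLeg x k t ↔ leg x t = k := by
  refine ⟨fun h => ?_, fun h => h ▸ hx.inLeg_leg ht⟩
  have h' := hx.inLeg_leg ht
  rcases lt_trichotomy (leg x t) k with hlt | heq | hgt
  · have := hx.monotone_arrival (show leg x t + 1 ≤ k from hlt)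
    linarith [h.1, h'.2]
  · exact heq
  · have := hx.monotone_arrival (show k + 1 ≤ leg x t from hgt)
    linarith [h'.1, h.2]

theorem leg_mono (hx : Regular x) {s t : ℝ} (hs : 0 ≤ s) (hst : s ≤ t) : leg x s ≤ leg x t := by
  by_contra! h
  have := hx.monotone_arrival (show leg x t + 1 ≤ leg x s from h)
  linarith [(hx.inLeg_leg hs).1, (hx.inLeg_leg (hs.trans hst)).2]

theorem stay_of_lt (hx : Regular x) {t : ℝ} (ht : 0 ≤ t) {k : ℕ} (hk : k < leg x t) :
    stay x k t = x k := by
  have h1 := (hx.monotone_arrival (show k + 1 ≤ leg x t from hk)).trans (hx.inLeg_leg ht).1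
  have h2 := arrival_succ x k
  have h3 := hx.nonneg k
  rw [stay, min_eq_left h1, min_eq_left (by linarith)]
  linarith

theorem stay_leg (hx : Regular x) {t : ℝ} (ht : 0 ≤ t) :
    stay x (leg x t) t = t - arrival x (leg x t) := by
  have h := hx.inLeg_leg ht
  rw [stay, min_eq_right h.2.le, min_eq_left h.1]

theorem stay_of_gt (hx : Regular x) {t : ℝ} (ht : 0 ≤ t) {k : ℕ} (hk : leg x t < k) :
    stay x k t = 0 := by
  have h := hx.inLeg_leg ht
  have h1 := hx.monotone_arrival (show leg x t + 1 ≤ k from hk)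
  have h2 := hx.monotone_arrival k.le_succ
  rw [stay, min_eq_right (by linarith [h.2, h2]), min_eq_right (by linarith [h.2]), sub_self]

/-- Legs not yet begun contribute 0, so `n` is free above the current leg: two times can share one
index range, and `n` can tend to infinity. -/
theorem path_eq_sum_stay (hx : Regular x) (y : ℕ → ℝ) {t : ℝ} (ht : 0 ≤ t) {n : ℕ}
    (hn : leg x t < n) : path x y t = ∑ k ∈ Finset.range n, stay x k t * y k := by
  have h0 : ∑ k ∈ Finset.range n, stay x k t * y k
      = ∑ k ∈ Finset.range (leg x t + 1), stay x k t * y k := by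
    refine (Finset.sum_subset (Finset.range_mono hn) fun k _ hk => ?_).symm
    rw [hx.stay_of_gt ht (by simpa using hk), zero_mul]
  rw [h0, Finset.sum_range_succ, hx.stay_leg ht, path]
  congr 1
  refine Finset.sum_congr rfl fun k hk => ?_
  rw [hx.stay_of_lt ht (Finset.mem_range.1 hk), mul_comm]

theorem stay_eq_integral (hx : Regular x) (k : ℕ) {t : ℝ} (ht : 0 ≤ t) :
    stay x k t = ∫ r in (0 : ℝ)..t, {r | InLeg x k r}.indicator (fun _ => (1 : ℝ)) r := by
  have h0 : 0 ≤ arrival x k := by simpa using hx.monotone_arrival k.zero_le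
  have h1 := hx.monotone_arrival k.le_succ
  have hset : {r | InLeg x k r} = Ico (arrival x k) (arrival x (k + 1)) := rfl
  -- Legs are closed on the left, so `(0, t]` is traded for `[0, t)`, which makes the intersection
  -- again a half-open interval.
  rw [hset, intervalIntegral.integral_of_le ht, ← integral_Ico_eq_integral_Ioc,
    setIntegral_indicator measurableSet_Ico, Ico_inter_Ico, sup_eq_right.2 h0]
  simp only [setIntegral_const, smul_eq_mul, mul_one, Real.volume_real_Ico, stay]
  rcases le_total t (arrival x k) with h | h
  · rw [min_eq_right h, min_eq_right (h.trans h1), inf_eq_left.2 (h.trans h1), sub_self,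
      max_eq_right (by linarith)]
  · rw [min_eq_left h, max_eq_left (sub_nonneg.2 (le_inf h h1)), min_comm]

end Regular

/-! ### Probability of sharing a leg, and the expected overlap. -/

/-- The times `r` and `q` belong to the same leg. -/
def SameLeg (x : ℕ → ℝ) (r q : ℝ) : Prop := ∃ k, InLeg x k r ∧ InLeg x k q

theorem measurableSet_sameLeg :
    MeasurableSet {p : (ℕ → ℝ) × (ℝ × ℝ) | SameLeg p.1 p.2.1 p.2.2} := by
  simp only [SameLeg, ofPred_exists]
  refine MeasurableSet.iUnion fun k => ?_
  exact ((measurable_fst.prodMk (measurable_fst.comp measurable_snd)) (measurableSet_inLeg k)).inter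
    ((measurable_fst.prodMk (measurable_snd.comp measurable_snd)) (measurableSet_inLeg k))

/-- Almost surely exactly one leg contains `r`. The survival factor up to `q` does not depend on the
number of that leg, so it comes out of the sum over legs, and the remaining probabilities add up to
1. -/
theorem durationLaw_sameLeg_of_le {lam : ℝ} (hl : 0 < lam) {r q : ℝ} (hr : 0 ≤ r) (hrq : r ≤ q) :
    durationLaw lam {x | SameLeg x r q} = ENNReal.ofReal (Real.exp (-(lam * (q - r)))) := by
  have hprob := isProbabilityMeasure_durationLaw hl
  have hreg := ae_durationLaw_regular hl
  have hA : ∀ k, MeasurableSet {x | arrival x k ≤ r ∧ q < arrival x (k + 1)} := fun k =>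
    (measurableSet_le (measurable_arrival k) measurable_const).inter
      (measurableSet_lt measurable_const (measurable_arrival (k + 1)))
  have hB : ∀ k, MeasurableSet {x | InLeg x k r} := fun k =>
    (measurable_id.prodMk measurable_const) (measurableSet_inLeg k)
  have hdisjB : Pairwise (Function.onFun (AEDisjoint (durationLaw lam))
      fun k => {x | InLeg x k r}) := by
    intro i j hij
    refine measure_eq_zero_iff_ae_notMem.2 ?_
    filter_upwards [hreg] with x hx hmem
    exact hij (((hx.inLeg_iff hr).1 hmem.1).symm.trans ((hx.inLeg_iff hr).1 hmem.2))
  have hdisjA : Pairwise (Function.onFun (AEDisjoint (durationLaw lam))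
      fun k => {x | arrival x k ≤ r ∧ q < arrival x (k + 1)}) := fun i j hij =>
    (hdisjB hij).mono (fun x hx => ⟨hx.1, hrq.trans_lt hx.2⟩)
      (fun x hx => ⟨hx.1, hrq.trans_lt hx.2⟩)
  have hunion : {x | SameLeg x r q} = ⋃ k, {x | arrival x k ≤ r ∧ q < arrival x (k + 1)} := by
    ext x
    simp only [SameLeg, InLeg, mem_ofPred_eq, mem_iUnion]
    exact exists_congr fun k => ⟨fun h => ⟨h.1.1, h.2.2⟩,
      fun h => ⟨⟨h.1, hrq.trans_lt h.2⟩, h.1.trans hrq, h.2⟩⟩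
  have hone : ∑' k, durationLaw lam {x | InLeg x k r} = 1 := by
    rw [← measure_iUnion₀ hdisjB fun k => (hB k).nullMeasurableSet, ← prob_compl_eq_zero_iff
      (MeasurableSet.iUnion hB)]
    refine measure_eq_zero_iff_ae_notMem.2 ?_
    filter_upwards [hreg] with x hx
    simp only [mem_compl_iff, mem_iUnion, not_not]
    exact ⟨_, hx.inLeg_leg hr⟩
  rw [hunion, measure_iUnion₀ hdisjA fun k => (hA k).nullMeasurableSet]
  simp_rw [durationLaw_arrival_le_lt hl _ hrq]
  rw [ENNReal.tsum_mul_left, hone, mul_one]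

theorem durationLaw_real_sameLeg {lam : ℝ} (hl : 0 < lam) {r q : ℝ} (hr : 0 ≤ r) (hq : 0 ≤ q) :
    (durationLaw lam).real {x | SameLeg x r q} = Real.exp (-(lam * |r - q|)) := by
  rcases le_total r q with h | h
  · rw [measureReal_def, durationLaw_sameLeg_of_le hl hr h, abs_of_nonpos (by linarith), neg_sub,
      ENNReal.toReal_ofReal (Real.exp_nonneg _)]
  · have : {x | SameLeg x r q} = {x | SameLeg x q r} := by
      ext x; simp [SameLeg, and_comm]
    rw [this, measureReal_def, durationLaw_sameLeg_of_le hl hq h, abs_of_nonneg (by linarith),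
      ENNReal.toReal_ofReal (Real.exp_nonneg _)]

/-- The measure of the pairs of times in `(0, s] × (0, t]` that belong to the same leg. -/
noncomputable def overlap (x : ℕ → ℝ) (s t : ℝ) : ℝ :=
  ∫ p, {p : ℝ × ℝ | SameLeg x p.1 p.2}.indicator (fun _ => (1 : ℝ)) p
    ∂(volume.restrict (Ioc 0 s)).prod (volume.restrict (Ioc 0 t))

theorem measurableSet_inLeg_right (x : ℕ → ℝ) (k : ℕ) : MeasurableSet {r | InLeg x k r} :=
  measurableSet_Ico

/-- Each stay is the integral of the indicator of its leg, so each product is an integral over a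
rectangle; the products of indicators sum over `k` to the indicator of sharing a leg. -/
theorem Regular.sum_stay_mul_stay {x : ℕ → ℝ} (hx : Regular x) {s t : ℝ} (hs : 0 ≤ s)
    (hst : s ≤ t) {n : ℕ} (hn : leg x t < n) :
    ∑ k ∈ Finset.range n, stay x k s * stay x k t = overlap x s t := by
  have hint : ∀ k a, Integrable ({r | InLeg x k r}.indicator fun _ => (1 : ℝ))
      (volume.restrict (Ioc 0 a)) := fun k a =>
    (integrable_const 1).indicator (measurableSet_inLeg_right x k)
  simp_rw [fun k => hx.stay_eq_integral k hs, fun k => hx.stay_eq_integral k (hs.trans hst),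
    intervalIntegral.integral_of_le hs, intervalIntegral.integral_of_le (hs.trans hst),
    ← integral_prod_mul]
  rw [← integral_finsetSum _ fun k _ => (hint k s).mul_prod (hint k t), overlap]
  rw [Measure.prod_restrict]
  refine setIntegral_congr_fun (measurableSet_Ioc.prod measurableSet_Ioc) fun p hp => ?_
  have hr : 0 ≤ p.1 := hp.1.1.le
  have hq : 0 ≤ p.2 := hp.2.1.le
  have hlt : leg x p.1 < n := (hx.leg_mono hr (hp.1.2.trans hst)).trans_lt hn
  classical
  simp only [indicator_apply, mem_ofPred_eq, SameLeg, hx.inLeg_iff hr, hx.inLeg_iff hq,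
    exists_eq_left', ite_mul, one_mul, zero_mul, Finset.sum_ite_eq, Finset.mem_range, hlt, if_true]

theorem integrable_overlap {lam : ℝ} (hl : 0 < lam) (s t : ℝ) :
    Integrable (fun x => overlap x s t) (durationLaw lam) := by
  have hprob := isProbabilityMeasure_durationLaw hl
  exact ((integrable_const (1 : ℝ)).indicator (f := fun _ : (ℕ → ℝ) × (ℝ × ℝ) => (1 : ℝ))
    (μ := (durationLaw lam).prod ((volume.restrict (Ioc 0 s)).prod (volume.restrict (Ioc 0 t))))
    measurableSet_sameLeg).integral_prod_left

/-- Fubini exchanges the expectation with the area, leaving the double integral of the same-leg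
probability. -/
theorem integral_overlap {lam : ℝ} (hl : 0 < lam) {s t : ℝ} (hs : 0 ≤ s) (hst : s ≤ t) :
    ∫ x, overlap x s t ∂durationLaw lam = covKernel lam s t := by
  have hprob := isProbabilityMeasure_durationLaw hl
  have hint : Integrable ({p : (ℕ → ℝ) × (ℝ × ℝ) | SameLeg p.1 p.2.1 p.2.2}.indicator
      fun _ => (1 : ℝ)) ((durationLaw lam).prod
        ((volume.restrict (Ioc 0 s)).prod (volume.restrict (Ioc 0 t)))) :=
    (integrable_const (1 : ℝ)).indicator measurableSet_sameLeg
  have h := integral_integral_swap (f := fun x p =>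
    {p : (ℕ → ℝ) × (ℝ × ℝ) | SameLeg p.1 p.2.1 p.2.2}.indicator (fun _ => (1 : ℝ)) (x, p)) hint
  have h2 : ∀ p : ℝ × ℝ, ∫ x, {p : (ℕ → ℝ) × (ℝ × ℝ) | SameLeg p.1 p.2.1 p.2.2}.indicator
      (fun _ => (1 : ℝ)) (x, p) ∂durationLaw lam
      = (durationLaw lam).real {x | SameLeg x p.1 p.2} := by
    intro p
    have hm : MeasurableSet {x | SameLeg x p.1 p.2} :=
      (measurable_id.prodMk measurable_const) measurableSet_sameLeg
    rw [← integral_indicator_one hm]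
    rfl
  have h3 : Integrable (fun p : ℝ × ℝ => Real.exp (-(lam * |p.1 - p.2|)))
      ((volume.restrict (Ioc 0 s)).prod (volume.restrict (Ioc 0 t))) := by
    refine Integrable.of_bound (by fun_prop : Continuous _).aestronglyMeasurable 1
      (ae_of_all _ fun p => ?_)
    rw [Real.norm_eq_abs, Real.abs_exp, Real.exp_le_one_iff, neg_nonpos]
    positivity
  simp_rw [h2] at h
  rw [← integral_integral_exp_neg_abs hl hs hst]
  refine h.trans ?_
  rw [intervalIntegral.integral_of_le hs]
  simp_rw [intervalIntegral.integral_of_le (hs.trans hst)]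
  rw [← integral_prod _ h3, Measure.prod_restrict]
  refine setIntegral_congr_fun (measurableSet_Ioc.prod measurableSet_Ioc) fun p hp => ?_
  exact durationLaw_real_sameLeg hl hp.1.1.le hp.2.1.le

/-! ### Second moments of velocities and of the path given the durations. -/

/-- The law of the sequence of velocities in one coordinate. -/
noncomputable def velocityLaw (σ : ℝ≥0) : Measure (ℕ → ℝ) :=
  Measure.infinitePi fun _ => gaussianReal 0 (σ ^ 2)

instance (σ : ℝ≥0) : IsProbabilityMeasure (velocityLaw σ) := by
  unfold velocityLaw; infer_instance

theorem measurePreserving_velocityLaw (σ : ℝ≥0) (k : ℕ) :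
    MeasurePreserving (fun y : ℕ → ℝ => y k) (velocityLaw σ) (gaussianReal 0 (σ ^ 2)) :=
  measurePreserving_eval_infinitePi (fun _ : ℕ => gaussianReal 0 (σ ^ 2)) k

theorem memLp_velocityLaw (σ : ℝ≥0) (k : ℕ) :
    MemLp (fun y : ℕ → ℝ => y k) 2 (velocityLaw σ) :=
  (memLp_id_gaussianReal' 2 (by simp)).comp_measurePreserving (measurePreserving_velocityLaw σ k)

theorem integrable_velocityLaw_mul (σ : ℝ≥0) (j k : ℕ) :
    Integrable (fun y : ℕ → ℝ => y j * y k) (velocityLaw σ) :=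
  (memLp_velocityLaw σ j).integrable_mul (memLp_velocityLaw σ k)

theorem integral_velocityLaw_eval (σ : ℝ≥0) (k : ℕ) : ∫ y, y k ∂velocityLaw σ = 0 := by
  have h := (measurePreserving_velocityLaw σ k).hasLaw.integral_eq
  rw [integral_id_gaussianReal] at h
  exact h

theorem integral_velocityLaw_mul (σ : ℝ≥0) (j k : ℕ) :
    ∫ y, y j * y k ∂velocityLaw σ = if j = k then (σ : ℝ) ^ 2 else 0 := by
  split_ifs with h
  · subst h
    have h1 := (measurePreserving_velocityLaw σ j).hasLaw.variance_eq
    rw [variance_id_gaussianReal, variance_of_integral_eq_zero (memLp_velocityLaw σ j).aestronglyMeasurable.aemeasurable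
      (integral_velocityLaw_eval σ j)] at h1
    simp_rw [← sq]
    rw [h1]
    simp
  · have hind : IndepFun (fun y : ℕ → ℝ => y j) (fun y => y k) (velocityLaw σ) :=
      (iIndepFun_infinitePi_eval fun _ : ℕ => gaussianReal 0 (σ ^ 2)).indepFun h
    rw [hind.integral_fun_mul_eq_mul_integral
      (memLp_velocityLaw σ j).aestronglyMeasurable (memLp_velocityLaw σ k).aestronglyMeasurable,
      integral_velocityLaw_eval, zero_mul]

namespace Regular

variable {x : ℕ → ℝ}

theorem path_mul_path (hx : Regular x) {s t : ℝ} (hs : 0 ≤ s) (hst : s ≤ t) (y : ℕ → ℝ) :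
    path x y s * path x y t = ∑ j ∈ Finset.range (leg x t + 1), ∑ k ∈ Finset.range (leg x t + 1),
      stay x j s * stay x k t * (y j * y k) := by
  rw [hx.path_eq_sum_stay y hs (Nat.lt_succ_of_le (hx.leg_mono hs hst)),
    hx.path_eq_sum_stay y (hs.trans hst) (Nat.lt_succ_self _), Finset.sum_mul_sum]
  exact Finset.sum_congr rfl fun _ _ => Finset.sum_congr rfl fun _ _ => by ring

theorem integrable_path_mul_path (hx : Regular x) (σ : ℝ≥0) {s t : ℝ} (hs : 0 ≤ s)
    (hst : s ≤ t) : Integrable (fun y => path x y s * path x y t) (velocityLaw σ) := by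
  simp_rw [hx.path_mul_path hs hst]
  exact integrable_finsetSum _ fun j _ => integrable_finsetSum _ fun k _ =>
    (integrable_velocityLaw_mul σ j k).const_mul _

/-- Off-diagonal velocity products have mean 0; the diagonal leaves the sum of products of stays. -/
theorem integral_path_mul_path (hx : Regular x) (σ : ℝ≥0) {s t : ℝ} (hs : 0 ≤ s)
    (hst : s ≤ t) : ∫ y, path x y s * path x y t ∂velocityLaw σ = (σ : ℝ) ^ 2 * overlap x s t := by
  simp_rw [hx.path_mul_path hs hst]
  rw [integral_finsetSum _ fun j _ => integrable_finsetSum _ fun k _ =>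
    (integrable_velocityLaw_mul σ j k).const_mul _]
  simp_rw [fun j => integral_finsetSum (Finset.range (leg x t + 1)) fun k _ =>
    (integrable_velocityLaw_mul σ j k).const_mul (stay x j s * stay x k t), integral_const_mul,
    integral_velocityLaw_mul, ← hx.sum_stay_mul_stay hs hst (Nat.lt_succ_self _), Finset.mul_sum]
  refine Finset.sum_congr rfl fun j hj => ?_
  simp only [mul_ite, mul_zero, Finset.sum_ite_eq, hj, if_true]
  ring

end Regular

/-! ### Second moments of the path under the joint law. -/

/-- The random index `leg` is avoided: the path is almost surely the limit of the measurable
truncated sums, which are eventually constant in `n`. -/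
theorem aestronglyMeasurable_path {lam : ℝ} (hl : 0 < lam) (σ : ℝ≥0) {t : ℝ} (ht : 0 ≤ t) :
    AEStronglyMeasurable (fun p : (ℕ → ℝ) × (ℕ → ℝ) => path p.1 p.2 t)
      ((durationLaw lam).prod (velocityLaw σ)) := by
  have hprob := isProbabilityMeasure_durationLaw hl
  refine aestronglyMeasurable_of_tendsto_ae atTop
    (f := fun n (p : (ℕ → ℝ) × (ℕ → ℝ)) => ∑ k ∈ Finset.range n, stay p.1 k t * p.2 k)
    (fun n => ?_) ?_
  · refine (Finset.measurable_sum _ fun k _ => Measurable.mul ?_ ?_).aestronglyMeasurable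
    · exact (((measurable_arrival (k + 1)).comp measurable_fst).min measurable_const).sub
        (((measurable_arrival k).comp measurable_fst).min measurable_const)
    · fun_prop
  · have h := (Measure.quasiMeasurePreserving_fst (ν := velocityLaw σ)).ae
      (ae_durationLaw_regular hl)
    filter_upwards [h] with p hp
    refine tendsto_const_nhds.congr' ?_
    filter_upwards [eventually_gt_atTop (leg p.1 t)] with n hn
    exact hp.path_eq_sum_stay p.2 ht hn

/-- Given the durations the square has integral `σ ^ 2 * overlap x t t`, which is integrable in the
durations. -/
theorem memLp_path {lam : ℝ} (hl : 0 < lam) (σ : ℝ≥0) {t : ℝ} (ht : 0 ≤ t) :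
    MemLp (fun p : (ℕ → ℝ) × (ℕ → ℝ) => path p.1 p.2 t) 2
      ((durationLaw lam).prod (velocityLaw σ)) := by
  have hprob := isProbabilityMeasure_durationLaw hl
  have hm := aestronglyMeasurable_path hl σ ht
  refine (memLp_two_iff_integrable_sq hm).2 ((integrable_prod_iff (hm.pow 2)).2 ⟨?_, ?_⟩)
  · filter_upwards [ae_durationLaw_regular hl] with x hx
    simpa only [sq, Pi.mul_apply] using hx.integrable_path_mul_path σ ht le_rfl
  · refine ((integrable_overlap hl t t).const_mul ((σ : ℝ) ^ 2)).congr ?_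
    filter_upwards [ae_durationLaw_regular hl] with x hx
    simp_rw [Pi.pow_apply, norm_pow, Real.norm_eq_abs, sq_abs, sq (path x _ t)]
    exact (hx.integral_path_mul_path σ ht le_rfl).symm

theorem integral_path_mul_path {lam : ℝ} (hl : 0 < lam) (σ : ℝ≥0) {s t : ℝ} (hs : 0 ≤ s) (hst : s ≤ t) :
    ∫ p : (ℕ → ℝ) × (ℕ → ℝ), path p.1 p.2 s * path p.1 p.2 t
      ∂(durationLaw lam).prod (velocityLaw σ) = (σ : ℝ) ^ 2 * covKernel lam s t := by
  have hprob := isProbabilityMeasure_durationLaw hl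
  have hint : Integrable (fun p : (ℕ → ℝ) × (ℕ → ℝ) => path p.1 p.2 s * path p.1 p.2 t)
      ((durationLaw lam).prod (velocityLaw σ)) :=
    (memLp_path hl σ hs).integrable_mul (memLp_path hl σ (hs.trans hst))
  rw [integral_prod _ hint,
    ← integral_overlap hl hs hst, ← integral_const_mul]
  refine integral_congr_ae ?_
  filter_upwards [ae_durationLaw_regular hl] with x hx
  exact hx.integral_path_mul_path σ hs hst

/-! ### Transfer to the model. -/

section model

variable {Ω : Type*} [MeasurableSpace Ω] {P : Measure Ω} {lam : ℝ} {σ : ℝ≥0} {τ u v : ℕ → Ω → ℝ}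

/-- By this symmetry each statement about the first coordinate also serves for the second. -/
theorem IsModel.swap (h : IsModel P lam σ τ u v) : IsModel P lam σ τ v u := by
  refine ⟨h.law_duration, h.law_velocity_y, h.law_velocity_x, ?_⟩
  have := h.indep.precomp (g := Sum.map id Sum.swap)
    (Function.injective_id.sumMap (Equiv.sumComm ℕ ℕ).injective)
  convert! this using 1
  ext (i | i | i) <;> rfl

theorem IsModel.hasLaw (h : IsModel P lam σ τ u v) (hl : 0 < lam) :
    HasLaw (fun ω => ((fun k => τ k ω), (fun k => u k ω)))
      ((durationLaw lam).prod (velocityLaw σ)) P := by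
  have := isProbabilityMeasure_expMeasure hl
  refine hasLaw_pair h.law_duration h.law_velocity_x ?_
  have := h.indep.precomp (g := Sum.map id Sum.inl)
    (Function.injective_id.sumMap Sum.inl_injective)
  convert! this using 1
  ext (i | i) <;> rfl

theorem IsModel.memLp_coord (h : IsModel P lam σ τ u v) (hl : 0 < lam) {t : ℝ} (ht : 0 ≤ t) :
    MemLp (coord τ u t) 2 P := by
  have hlaw := h.hasLaw hl
  have hp := memLp_path hl σ ht
  rw [← hlaw.map_eq] at hp
  -- `coord τ u t` unfolds to `path` composed with the pair of sequences of durations and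
  -- velocities.
  exact hp.comp_of_map hlaw.aemeasurable

theorem IsModel.integral_coord_mul_coord (h : IsModel P lam σ τ u v) (hl : 0 < lam) {s t : ℝ}
    (hs : 0 ≤ s) (hst : s ≤ t) :
    ∫ ω, coord τ u s ω * coord τ u t ω ∂P = (σ : ℝ) ^ 2 * covKernel lam s t := by
  rw [← integral_path_mul_path hl σ hs hst]
  exact (h.hasLaw hl).integral_comp
    ((memLp_path hl σ hs).integrable_mul (memLp_path hl σ (hs.trans hst))).aestronglyMeasurable

theorem IsModel.integrable_sq_coord_sub (h : IsModel P lam σ τ u v) (hl : 0 < lam) {T t : ℝ}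
    (ht : t ∈ Icc 0 T) :
    Integrable (fun ω => (coord τ u t ω - estCoord τ u T t ω) ^ 2) P := by
  refine ((h.memLp_coord hl ht.1).sub
    (((h.memLp_coord hl (ht.1.trans ht.2)).const_mul (t / T)))).integrable_sq.congr
    (ae_of_all _ fun ω => ?_)
  simp only [Pi.sub_apply, estCoord]
  ring

theorem IsModel.integral_sq_coord_sub (h : IsModel P lam σ τ u v) (hl : 0 < lam) {T t : ℝ}
    (ht : t ∈ Icc 0 T) :
    ∫ ω, (coord τ u t ω - estCoord τ u T t ω) ^ 2 ∂P
      = (σ : ℝ) ^ 2 * (covKernel lam t t - 2 * (t / T) * covKernel lam t T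
        + (t / T) ^ 2 * covKernel lam T T) := by
  have hT := ht.1.trans ht.2
  have mt := h.memLp_coord hl ht.1
  have mT := h.memLp_coord hl hT
  have i1 : Integrable (fun ω => coord τ u t ω * coord τ u t ω) P := mt.integrable_mul mt
  have i2 : Integrable (fun ω => 2 * (t / T) * (coord τ u t ω * coord τ u T ω)) P :=
    (mt.integrable_mul mT).const_mul (2 * (t / T))
  have i3 : Integrable (fun ω => (t / T) ^ 2 * (coord τ u T ω * coord τ u T ω)) P :=
    (mT.integrable_mul mT).const_mul ((t / T) ^ 2)
  have e : ∀ ω, (coord τ u t ω - estCoord τ u T t ω) ^ 2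
      = coord τ u t ω * coord τ u t ω - 2 * (t / T) * (coord τ u t ω * coord τ u T ω)
        + (t / T) ^ 2 * (coord τ u T ω * coord τ u T ω) := by
    intro ω
    simp only [estCoord]
    ring
  have i12 : Integrable (fun ω => coord τ u t ω * coord τ u t ω
      - 2 * (t / T) * (coord τ u t ω * coord τ u T ω)) P := i1.sub i2
  simp_rw [e]
  rw [integral_add i12 i3, integral_sub i1 i2, integral_const_mul, integral_const_mul,
    h.integral_coord_mul_coord hl ht.1 le_rfl, h.integral_coord_mul_coord hl ht.1 ht.2,
    h.integral_coord_mul_coord hl hT le_rfl]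
  ring

theorem IsModel.integrable_sqError (h : IsModel P lam σ τ u v) (hl : 0 < lam) {T t : ℝ}
    (ht : t ∈ Icc 0 T) : Integrable (sqError τ u v T t) P :=
  (h.integrable_sq_coord_sub hl ht).add (h.swap.integrable_sq_coord_sub hl ht)

theorem IsModel.errorAt_eq (h : IsModel P lam σ τ u v) (hl : 0 < lam) {T t : ℝ} (hT : 0 < T)
    (ht : t ∈ Icc 0 T) : errorAt P τ u v T t = errorFormula σ lam T t := by
  rw [← covKernel_combination hl.ne' hT.ne', two_mul]
  -- The two equal summands are read differently: the first as the `u` coordinate, the second as the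
  -- `v` coordinate.
  nth_rewrite 1 [← h.integral_sq_coord_sub hl ht]
  rw [← h.swap.integral_sq_coord_sub hl ht]
  exact integral_add (h.integrable_sq_coord_sub hl ht) (h.swap.integrable_sq_coord_sub hl ht)

theorem continuous_errorFormula (σ lam T : ℝ) : Continuous (errorFormula σ lam T) := by
  unfold errorFormula; fun_prop

theorem IsModel.intervalIntegrable_errorAt (h : IsModel P lam σ τ u v) (hl : 0 < lam) {T : ℝ}
    (hT : 0 < T) : IntervalIntegrable (errorAt P τ u v T) volume 0 T := by
  refine ((continuous_errorFormula σ lam T).intervalIntegrable 0 T).congr fun t ht => ?_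
  rw [uIoc_of_le hT.le] at ht
  exact (h.errorAt_eq hl hT ⟨ht.1.le, ht.2⟩).symm

theorem IsModel.errorAvg_eq (h : IsModel P lam σ τ u v) (hl : 0 < lam) {T : ℝ} (hT : 0 < T) :
    errorAvg P τ u v T = errorAvgFormula σ lam T := by
  rw [← integral_errorFormula hl.ne' hT.ne', errorAvg]
  congr 1
  refine intervalIntegral.integral_congr fun t ht => ?_
  rw [uIcc_of_le hT.le] at ht
  exact h.errorAt_eq hl hT ht

end model

end RandomWaypoint

theorem mainTheorem1 (σ : NNReal) :
    (∀ (Ω : Type*) [MeasurableSpace Ω] (P : MeasureTheory.Measure Ω)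
        [MeasureTheory.IsProbabilityMeasure P] (τ u v : ℕ → Ω → ℝ) (lam T : ℝ),
        0 < lam → 0 < T → RandomWaypoint.IsModel P lam σ τ u v →
        (∀ t ∈ Set.Icc 0 T,
          MeasureTheory.Integrable (RandomWaypoint.sqError τ u v T t) P ∧
          RandomWaypoint.errorAt P τ u v T t =
            4 * (σ : ℝ) ^ 2 / (lam ^ 2 * T ^ 2) *
              (t ^ 2 * (lam * (T - t) - 1 + Real.exp (-(lam * (T - t))))
                + (T - t) ^ 2 * (lam * t - 1 + Real.exp (-(lam * t)))
                - (1 + Real.exp (-(lam * T))) * (t * (T - t))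
                + t * (T - t) * Real.exp (-(lam * t))
                + t * (T - t) * Real.exp (-(lam * (T - t))))) ∧
        IntervalIntegrable (RandomWaypoint.errorAt P τ u v T) MeasureTheory.volume 0 T ∧
        RandomWaypoint.errorAvg P τ u v T =
          2 * (σ : ℝ) ^ 2 / (3 * lam ^ 2) *
            (lam * T - 5 + 12 / (lam * T) - 12 / (lam * T) ^ 2
              + 12 / (lam * T) ^ 2 * Real.exp (-(lam * T)) - Real.exp (-(lam * T)))) ∧
    (∀ (C : ℝ), 0 < C →
      ∀ (Ω : ℝ → Type*) [∀ T, MeasurableSpace (Ω T)] (P : ∀ T, MeasureTheory.Measure (Ω T))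
        [∀ T, MeasureTheory.IsProbabilityMeasure (P T)] (τ u v : ∀ T, ℕ → Ω T → ℝ),
        (∀ T, 0 < T → RandomWaypoint.IsModel (P T) (T / C) σ (τ T) (u T) (v T)) →
        Filter.Tendsto (fun T => RandomWaypoint.errorAvg (P T) (τ T) (u T) (v T) T)
          Filter.atTop (nhds (2 * (σ : ℝ) ^ 2 * C / 3))) := by
  refine ⟨?_, ?_⟩
  · intro Ω _ P _ τ u v lam T hl hT h
    exact ⟨fun t ht => ⟨h.integrable_sqError hl ht, h.errorAt_eq hl hT ht⟩,
      h.intervalIntegrable_errorAt hl hT, h.errorAvg_eq hl hT⟩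
  · intro C hC Ω _ P _ τ u v h
    refine (RandomWaypoint.tendsto_errorAvgFormula σ hC).congr' ?_
    filter_upwards [Filter.eventually_gt_atTop 0] with T hT
    exact ((h T hT).errorAvg_eq (div_pos hT hC) hT).symm
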